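/- All designs are matrices whose entries are functions of finitely many complex variables, and all sizes are positive integers. A generalized linear complex orthogonal design (GLCOD) of size $p\times N$ in $k\ge 1$ complex variables $x_1,\dots,x_k$, where $p\ge N\ge 1$, is a $p\times N$ matrix $\Theta(x_1,\dots,x_k)$ such that (i) every entry is a complex linear combination of $x_1,\dots,x_k$ and their conjugates $x_1^*,\dots,x_k^*$, and (ii) $\Theta^{\mathcal H}\Theta$ is a diagonal matrix each of whose diagonal entries is a linear combination of $|x_1|^2,\dots,|x_k|^2$ with all coefficients real and strictly positive. Let $K$ be even. A generalized co-ordinate interleaved orthogonal design (GCIOD) for $N$ transmit antennas in complex variables $x_0,\dots,x_{K-1}$ is an $L\times N$ matrix of the form $$S(x_0,\dots,x_{K-1})=\begin{bmatrix}\Theta_1(\tilde x_0,\dots,\tilde x_{K/2-1}) & 0\\ 0 & \Theta_2(\tilde x_{K/2},\dots,\tilde x_{K-1})\end{bmatrix},\qquad \tilde x_i=\operatorname{Re}(x_i)+\mathbf{j}\operatorname{Im}\bigl(x_{(i+K/2)\bmod K}\bigr),$$ where $\Theta_1$ and $\Theta_2$ are GLCODs in $K/2$ variables of sizes $L_1\times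 N_1$ and $L_2\times N_2$ respectively, with $L_1+L_2=L$ and $N_1+N_2=N$. Its rate is $K/L$. **Theorem.** For a given number $N$ of transmit antennas there is a GCIOD of rate one (for some $K$ and $L$) if and only if $N\in\{2,3,4\}$. -/

import Mathlib

open scoped Matrix

/-- An `L × N` matrix whose entries are functions of `K` complex variables. Rows are time slots,
columns are transmit antennas. -/
abbrev Design (K L N : ℕ) : Type := (Fin K → ℂ) → Matrix (Fin L) (Fin N) ℂ

/-- The rate of an `L × N` design in `K` complex variables is `K / L`. -/
def Design.rate {K L N : ℕ} (_S : Design K L N) : ℚ := (K : ℚ) / (L : ℚ)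

/-- A Generalized Linear Complex Orthogonal Design of size `p × N` in `k` complex variables. -/
structure IsGLCOD {k p N : ℕ} (Θ : Design k p N) : Prop where
  vars_pos : 0 < k
  size_pos : 0 < N
  size_le : N ≤ p
  /-- The entries are complex linear combinations of the variables and their conjugates. -/
  linear : ∃ a b : Fin p → Fin N → Fin k → ℂ, ∀ (x : Fin k → ℂ) (i : Fin p) (j : Fin N),
    Θ x i j = ∑ l, (a i j l * x l + b i j l * star (x l))
  /-- `Θᴴ Θ` is diagonal, with entries combinations of the `|x_l|²` with positive coefficients. -/
  orthogonal : ∃ d : Fin N → Fin k → ℝ, (∀ j l, 0 < d j l) ∧ ∀ x : Fin k → ℂ,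
    (Θ x)ᴴ * Θ x = Matrix.diagonal fun j => ((∑ l, d j l * ‖x l‖ ^ 2 : ℝ) : ℂ)

/-- Co-ordinate interleaving: `x̃_i = Re x_i + 𝐣 Im x_{(i + K/2) mod K}`. -/
def interleave {K : ℕ} (x : Fin K → ℂ) (i : Fin K) : ℂ :=
  ⟨(x i).re, (x ⟨(i.val + K / 2) % K, Nat.mod_lt _ i.pos⟩).im⟩

/-- The first half `(y_0, …, y_{K/2-1})` of a tuple `y`. -/
def firstHalf {K : ℕ} (y : Fin K → ℂ) : Fin (K / 2) → ℂ :=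
  fun i => y ⟨i.val, by omega⟩

/-- For even `K`, the second half `(y_{K/2}, …, y_{K-1})` of a tuple `y`. -/
def secondHalf {K : ℕ} (y : Fin K → ℂ) : Fin (K / 2) → ℂ :=
  fun i => y ⟨i.val + K / 2, by omega⟩

/-- A Generalized Co-ordinate Interleaved Orthogonal Design: an `L × N` design in `K` variables,
`K` even, that is block diagonal with blocks `Θ₁(x̃_0, …, x̃_{K/2-1})` and
`Θ₂(x̃_{K/2}, …, x̃_{K-1})`, where `Θ₁`, `Θ₂` are GLCODs of sizes `L₁ × N₁` and `L₂ × N₂`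
with `L₁ + L₂ = L` and `N₁ + N₂ = N`. -/
def IsGCIOD {K L N : ℕ} (S : Design K L N) : Prop :=
  Even K ∧
  ∃ (L₁ L₂ N₁ N₂ : ℕ) (hL : L₁ + L₂ = L) (hN : N₁ + N₂ = N)
    (Θ₁ : Design (K / 2) L₁ N₁) (Θ₂ : Design (K / 2) L₂ N₂),
    IsGLCOD Θ₁ ∧ IsGLCOD Θ₂ ∧
    ∀ x : Fin K → ℂ, S x =
      Matrix.reindex (finSumFinEquiv.trans (finCongr hL)) (finSumFinEquiv.trans (finCongr hN))
        (Matrix.fromBlocks (Θ₁ (firstHalf (interleave x))) 0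
          0 (Θ₂ (secondHalf (interleave x))))

/-! Interleaving plays no part: only the block sizes matter. Each column of a GLCOD is an injective
real-linear map, so each block has at least K/2 rows; rate one leaves no slack, and both blocks have
exactly K/2 rows. Columns are then bijections, and using one column as coordinates turns two others
into conjugate-linear maps `f`, `g` with `f y` orthogonal to `g y`. Then ⟪f y, g z⟫ is sesquilinear
and zero on the diagonal, hence zero, contradicting surjectivity. So each block has one or two
columns, and both counts occur. -/

open scoped InnerProductSpace

section Semilinear

variable {E : Type*} [NormedAddCommGroup E] [InnerProductSpace ℂ E]

/-- A real-linear endomorphism moving every vector into its orthogonal complement is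
conjugate-linear. -/
lemma map_I_smul_of_inner_self_map_eq_zero {f : E →ₗ[ℝ] E} (hf : ∀ y, ⟪y, f y⟫_ℂ = 0) (z : E) :
    f (Complex.I • z) = -(Complex.I • f z) := by
  have polar : ∀ y z, ⟪y, f z⟫_ℂ = -⟪z, f y⟫_ℂ := by
    intro y z
    have h := hf (y + z)
    simp only [map_add, inner_add_left, inner_add_right, hf] at h
    linear_combination h
  -- By `polar`, pairing `y` with `f z` equals an expression conjugate-linear in `z`.
  refine ext_inner_left ℂ fun y => ?_
  rw [polar y, inner_smul_left, inner_neg_right, inner_smul_right, polar y z, Complex.conj_I]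
  ring

/-- Two conjugate-linear maps with pointwise orthogonal values have orthogonal ranges. -/
lemma inner_map_map_eq_zero {f g : E →ₗ[ℝ] E}
    (hf : ∀ z, f (Complex.I • z) = -(Complex.I • f z))
    (hg : ∀ z, g (Complex.I • z) = -(Complex.I • g z))
    (hfg : ∀ y, ⟪f y, g y⟫_ℂ = 0) (y z : E) : ⟪f y, g z⟫_ℂ = 0 := by
  have polar : ∀ y z, ⟪f y, g z⟫_ℂ + ⟪f z, g y⟫_ℂ = 0 := by
    intro y z
    have h := hfg (y + z)
    simp only [map_add, inner_add_left, inner_add_right, hfg] at h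
    linear_combination h
  -- Replacing `y` by `I • y` flips the relative sign of the two terms, so both vanish.
  have h := polar (Complex.I • y) z
  rw [hf, hg, inner_neg_left, inner_neg_right, inner_smul_left, inner_smul_right,
    Complex.conj_I] at h
  linear_combination (1 / 2 : ℂ) * polar y z - (1 / 2 : ℂ) * Complex.I * h +
    (1 / 2 : ℂ) * (⟪f y, g z⟫_ℂ - ⟪f z, g y⟫_ℂ) * Complex.I_sq

/-- Three real-linear bijections onto a complex inner product space cannot have pairwise orthogonal
values, unless the space is trivial. -/
lemma subsingleton_of_three_orthogonal_bijections {V : Type*} [AddCommGroup V] [Module ℝ V]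
    {A B C : V →ₗ[ℝ] E} (hA : Function.Bijective A) (hB : Function.Bijective B)
    (hC : Function.Bijective C) (hAB : ∀ x, ⟪A x, B x⟫_ℂ = 0) (hAC : ∀ x, ⟪A x, C x⟫_ℂ = 0)
    (hBC : ∀ x, ⟪B x, C x⟫_ℂ = 0) : Subsingleton E := by
  let e := LinearEquiv.ofBijective A hA
  have he : ∀ y, A (e.symm y) = y := e.apply_symm_apply
  have hf := map_I_smul_of_inner_self_map_eq_zero (f := B ∘ₗ e.symm.toLinearMap) fun y => by
    simpa [he] using hAB (e.symm y)
  have hg := map_I_smul_of_inner_self_map_eq_zero (f := C ∘ₗ e.symm.toLinearMap) fun y => by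
    simpa [he] using hAC (e.symm y)
  have h := inner_map_map_eq_zero hf hg fun y => hBC (e.symm y)
  refine subsingleton_of_forall_eq 0 fun w => ?_
  obtain ⟨v, rfl⟩ := hC.2 w
  -- Since `C v` is also a value of `B`, it is orthogonal to itself.
  obtain ⟨u, hu⟩ := hB.2 (C v)
  have := h (A u) (A v)
  have hs : ∀ v, e.symm (A v) = v := e.symm_apply_apply
  simpa [hs, hu] using this

end Semilinear

namespace IsGLCOD

variable {k p N : ℕ} {Θ : Design k p N}

/-- A column of a GLCOD, as a real-linear function of the variables. -/
noncomputable def column (h : IsGLCOD Θ) (j : Fin N) :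
    (Fin k → ℂ) →ₗ[ℝ] EuclideanSpace ℂ (Fin p) where
  toFun x := WithLp.toLp 2 fun i => Θ x i j
  map_add' x y := by
    obtain ⟨a, b, hab⟩ := h.linear
    ext i
    simp only [hab, PiLp.add_apply, Pi.add_apply, star_add, ← Finset.sum_add_distrib]
    exact Finset.sum_congr rfl fun l _ => by ring
  map_smul' c x := by
    obtain ⟨a, b, hab⟩ := h.linear
    ext i
    simp only [hab, PiLp.smul_apply, Pi.smul_apply, Complex.real_smul, star_mul',
      Complex.star_def, Complex.conj_ofReal, Finset.mul_sum, RingHom.id_apply]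
    exact Finset.sum_congr rfl fun l _ => by ring

lemma inner_column (h : IsGLCOD Θ) (j j' : Fin N) (x : Fin k → ℂ) :
    ⟪h.column j x, h.column j' x⟫_ℂ = ((Θ x)ᴴ * Θ x) j j' := by
  simp [column, PiLp.inner_apply, Matrix.mul_apply, mul_comm]

lemma inner_column_of_ne (h : IsGLCOD Θ) {j j' : Fin N} (hj : j ≠ j') (x : Fin k → ℂ) :
    ⟪h.column j x, h.column j' x⟫_ℂ = 0 := by
  obtain ⟨d, -, hd⟩ := h.orthogonal
  rw [inner_column, hd, Matrix.diagonal_apply_ne _ hj]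

/-- The squared norm of a column is a diagonal entry of `ΘᴴΘ`, a positive definite form in the
variables. -/
lemma column_injective (h : IsGLCOD Θ) (j : Fin N) : Function.Injective (h.column j) := by
  obtain ⟨d, hpos, hd⟩ := h.orthogonal
  rw [injective_iff_map_eq_zero]
  intro x hx
  have h0 := h.inner_column j j x
  rw [hx, inner_zero_left, hd, Matrix.diagonal_apply_eq, eq_comm, Complex.ofReal_eq_zero,
    Finset.sum_eq_zero_iff_of_nonneg fun l _ => by have := hpos j l; positivity] at h0
  ext l
  simpa [(hpos j l).ne'] using h0 l (Finset.mem_univ l)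

lemma finrank_complex_vectors (k : ℕ) : Module.finrank ℝ (Fin k → ℂ) = k * 2 := by
  simp [Module.finrank_pi_fintype, Complex.finrank_real_complex]

lemma finrank_complex_euclidean (p : ℕ) :
    Module.finrank ℝ (EuclideanSpace ℂ (Fin p)) = p * 2 := by
  rw [← finrank_complex_vectors p]
  exact (WithLp.linearEquiv 2 ℝ (Fin p → ℂ)).finrank_eq

/-- The rate of a GLCOD is at most one. -/
lemma vars_le (h : IsGLCOD Θ) : k ≤ p := by
  have := LinearMap.finrank_le_finrank_of_injective (h.column_injective ⟨0, h.size_pos⟩)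
  rw [finrank_complex_vectors, finrank_complex_euclidean] at this
  omega

lemma column_bijective {Θ : Design k k N} (h : IsGLCOD Θ) (j : Fin N) :
    Function.Bijective (h.column j) :=
  ⟨h.column_injective j, (LinearMap.injective_iff_surjective_of_finrank_eq_finrank
    (by rw [finrank_complex_vectors, finrank_complex_euclidean])).1 (h.column_injective j)⟩

/-- A rate-one GLCOD has at most two columns. -/
lemma columns_le_two {Θ : Design k k N} (h : IsGLCOD Θ) : N ≤ 2 := by
  by_contra! hN
  have : Subsingleton (EuclideanSpace ℂ (Fin k)) :=
    subsingleton_of_three_orthogonal_bijections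
      (h.column_bijective ⟨0, by omega⟩) (h.column_bijective ⟨1, by omega⟩)
      (h.column_bijective ⟨2, by omega⟩) (h.inner_column_of_ne (by simp))
      (h.inner_column_of_ne (by simp)) (h.inner_column_of_ne (by simp))
  have hfin := finrank_complex_euclidean k
  rw [Module.finrank_zero_of_subsingleton] at hfin
  have := h.vars_pos
  omega

end IsGLCOD

/-- The two variables in a single column. -/
def columnDesign : Design 2 2 1 := fun x => !![x 0; x 1]

/-- The Alamouti design. -/
def alamouti : Design 2 2 2 := fun x => !![x 0, x 1; -star (x 1), star (x 0)]

lemma isGLCOD_columnDesign : IsGLCOD columnDesign where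
  vars_pos := by norm_num
  size_pos := by norm_num
  size_le := by norm_num
  linear := by
    refine ⟨fun i _ l => if l = i then 1 else 0, fun _ _ _ => 0, fun x i j => ?_⟩
    fin_cases i <;> fin_cases j <;> simp [columnDesign]
  orthogonal := by
    refine ⟨fun _ _ => 1, by simp, fun x => ?_⟩
    ext i j
    fin_cases i; fin_cases j
    simp [columnDesign, Matrix.mul_apply, Complex.conj_mul']

lemma isGLCOD_alamouti : IsGLCOD alamouti where
  vars_pos := by norm_num
  size_pos := by norm_num
  size_le := le_rfl
  linear := by
    refine ⟨fun i j l => if i = 0 ∧ l = j then 1 else 0,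
      fun i j l => if i = 1 ∧ l ≠ j then (if j = 0 then -1 else 1) else 0, fun x i j => ?_⟩
    fin_cases i <;> fin_cases j <;> simp [alamouti]
  orthogonal := by
    refine ⟨fun _ _ => 1, by simp, fun x => ?_⟩
    ext i j
    fin_cases i <;> fin_cases j <;>
      simp [alamouti, Matrix.mul_apply, Complex.conj_mul'] <;> ring

/-- Two GLCODs in two variables with two rows each make up a rate-one GCIOD. -/
lemma exists_rate_one_GCIOD {N₁ N₂ : ℕ} {Θ₁ : Design 2 2 N₁} {Θ₂ : Design 2 2 N₂}
    (h₁ : IsGLCOD Θ₁) (h₂ : IsGLCOD Θ₂) :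
    ∃ (K L : ℕ) (S : Design K L (N₁ + N₂)), IsGCIOD S ∧ S.rate = 1 :=
  ⟨4, 4, _, ⟨by decide, 2, 2, N₁, N₂, rfl, rfl, Θ₁, Θ₂, h₁, h₂, fun _ => rfl⟩,
    by norm_num [Design.rate]⟩

theorem theorem10 (N : ℕ) :
    (∃ (K L : ℕ) (S : Design K L N), IsGCIOD S ∧ S.rate = 1) ↔ N = 2 ∨ N = 3 ∨ N = 4 := by
  constructor
  · rintro ⟨K, L, S, ⟨hK, L₁, L₂, N₁, N₂, hL, hN, Θ₁, Θ₂, h₁, h₂, -⟩, hrate⟩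
    have hKL : K = L := by
      rw [Design.rate] at hrate
      -- No separate case `L = 0` is needed: the quotient would then be 0, not 1.
      exact_mod_cast eq_of_div_eq_one hrate
    have hK2 := Nat.two_mul_div_two_of_even hK
    have hL₁ : L₁ = K / 2 := by have := h₁.vars_le; have := h₂.vars_le; omega
    have hL₂ : L₂ = K / 2 := by omega
    subst hL₁ hL₂
    have := h₁.columns_le_two
    have := h₂.columns_le_two
    have := h₁.size_pos
    have := h₂.size_pos
    omega
  · rintro (rfl | rfl | rfl)
    · exact exists_rate_one_GCIOD isGLCOD_columnDesign isGLCOD_columnDesign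
    · exact exists_rate_one_GCIOD isGLCOD_alamouti isGLCOD_columnDesign
    · exact exists_rate_one_GCIOD isGLCOD_alamouti isGLCOD_alamouti
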